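/- All Banach lattices are real. A Banach lattice $Y$ is called uniformly monotone if for every $0<\varepsilon<1$ there is $0<\delta(\varepsilon)\le\varepsilon$ such that for all $x,y\in Y$ with $x,y\ge 0$, $$\|x\|=1,\quad \|x+y\|\le 1+\delta(\varepsilon)\ \Longrightarrow\ \|y\|\le\varepsilon ;$$ any function $\delta$ with this property is called a modulus of uniform monotonicity of $Y$. A weak unit of $Y$ is an element $e\ge 0$ such that $e\wedge|x|=0$ implies $x=0$. For a locally compact Hausdorff space $L$, $C_0(L)$ is the Banach lattice of real continuous functions on $L$ vanishing at infinity, with the supremum norm and the pointwise order. A pair $(X,Y)$ of Banach lattices has the Bishop–Phelps–Bollobás property for positive operators if for every $0<\varepsilon<1$ there is $0<\eta(\varepsilon)<\varepsilon$ such that for every bounded linear operator $S:X\to Y$ with $S\ge 0$ and $\|S\|=1$ and every $x_0\in X$ with $\|x_0\|=1$ and $\|S(x_0)\|>1-\eta(\varepsilon)$, there exist $u_0\in X$ with $\|u_0\|=1$ and a bounded linear operator $T:X\to Y$ with $T\ge 0$ and $\|T\|=1$ satisfying $$\|T(u_0)\|=1,\qquad \|u_0-x_0\|<\varepsilon,\qquad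 \|T-S\|<\varepsilon .$$ Theorem. For every locally compact Hausdorff space $L$ and every uniformly monotone Banach lattice $Y$ with a weak unit, the pair $(C_0(L),Y)$ has the Bishop–Phelps–Bollobás property for positive operators. Moreover, the function $\eta$ depends only on the modulus of uniform monotonicity of $Y$: for every function $\delta$ there is a function $\eta$ such that, for every locally compact Hausdorff space $L$ and every Banach lattice $Y$ with a weak unit for which $\delta$ is a modulus of uniform monotonicity, the pair $(C_0(L),Y)$ satisfies the definition of the property with this $\eta$. -/

import Mathlib

universe u v

open scoped ZeroAtInfty

/-! ### The space `C₀(L, ℝ)` as a Banach lattice, with the pointwise order -/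

namespace ZeroAtInftyContinuousMap

variable {L : Type*} [TopologicalSpace L]

instance instLEReal : LE C₀(L, ℝ) := ⟨fun f g => ∀ t, f t ≤ g t⟩

instance instLTReal : LT C₀(L, ℝ) := ⟨fun f g => f ≤ g ∧ ¬ g ≤ f⟩

instance instMaxReal : Max C₀(L, ℝ) :=
  ⟨fun f g =>
    { toFun := fun t => f t ⊔ g t
      continuous_toFun := (map_continuous f).sup (map_continuous g)
      zero_at_infty' := by
        simpa using (zero_at_infty f).max (zero_at_infty g) }⟩

instance instMinReal : Min C₀(L, ℝ) :=
  ⟨fun f g =>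
    { toFun := fun t => f t ⊓ g t
      continuous_toFun := (map_continuous f).inf (map_continuous g)
      zero_at_infty' := by
        simpa using (zero_at_infty f).min (zero_at_infty g) }⟩

theorem le_iff_real {f g : C₀(L, ℝ)} : f ≤ g ↔ ∀ t, f t ≤ g t := Iff.rfl

theorem sup_apply_real (f g : C₀(L, ℝ)) (t : L) : (f ⊔ g) t = f t ⊔ g t := rfl

theorem inf_apply_real (f g : C₀(L, ℝ)) (t : L) : (f ⊓ g) t = f t ⊓ g t := rfl

instance instLatticeReal : Lattice C₀(L, ℝ) where
  le_refl _ _ := le_rfl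
  le_trans _ _ _ h₁ h₂ t := (h₁ t).trans (h₂ t)
  lt_iff_le_not_ge _ _ := Iff.rfl
  le_antisymm _ _ h₁ h₂ := ext fun t => le_antisymm (h₁ t) (h₂ t)
  sup := (· ⊔ ·)
  inf := (· ⊓ ·)
  le_sup_left _ _ _ := le_sup_left
  le_sup_right _ _ _ := le_sup_right
  sup_le _ _ _ h₁ h₂ t := sup_le (h₁ t) (h₂ t)
  inf_le_left _ _ _ := inf_le_left
  inf_le_right _ _ _ := inf_le_right
  le_inf _ _ _ h₁ h₂ t := le_inf (h₁ t) (h₂ t)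

theorem abs_apply_real (f : C₀(L, ℝ)) (t : L) : |f| t = |f t| := rfl

instance instIsOrderedAddMonoidReal : IsOrderedAddMonoid C₀(L, ℝ) where
  add_le_add_left _ _ h k t := add_le_add_left (h t) (k t)

instance instIsOrderedModuleReal : IsOrderedModule ℝ C₀(L, ℝ) where
  smul_le_smul_of_nonneg_left _ ha _ _ h t := mul_le_mul_of_nonneg_left (h t) ha
  smul_le_smul_of_nonneg_right _ hf _ _ h t := mul_le_mul_of_nonneg_right h (hf t)

instance instHasSolidNormReal : HasSolidNorm C₀(L, ℝ) where
  solid f g h := by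
    rw [← norm_toBCF_eq_norm (f := f), ← norm_toBCF_eq_norm (f := g)]
    exact (BoundedContinuousFunction.norm_le (norm_nonneg _)).2 fun t =>
      (h t).trans (g.toBCF.norm_coe_le_norm t)

end ZeroAtInftyContinuousMap

/-! ### Uniform monotonicity and weak units -/

/-- `δ` is a modulus of uniform monotonicity of `Y`: it witnesses, for every `0 < ε < 1`,
the definition of uniform monotonicity. Only the values of `δ` on `(0, 1)` matter. -/
def IsUniformMonotonicityModulus (Y : Type*) [NormedAddCommGroup Y] [Lattice Y]
    (δ : ℝ → ℝ) : Prop :=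
  ∀ ε : ℝ, 0 < ε → ε < 1 → 0 < δ ε ∧ δ ε ≤ ε ∧
    ∀ x y : Y, 0 ≤ x → 0 ≤ y → ‖x‖ = 1 → ‖x + y‖ ≤ 1 + δ ε → ‖y‖ ≤ ε

/-- `Y` is uniformly monotone. -/
def UniformlyMonotone (Y : Type*) [NormedAddCommGroup Y] [Lattice Y] : Prop :=
  ∀ ε : ℝ, 0 < ε → ε < 1 → ∃ δ : ℝ, 0 < δ ∧ δ ≤ ε ∧
    ∀ x y : Y, 0 ≤ x → 0 ≤ y → ‖x‖ = 1 → ‖x + y‖ ≤ 1 + δ → ‖y‖ ≤ ε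

/-- `e` is a weak unit of `Y`: a positive element such that only `0` is disjoint from `e`. -/
def IsWeakUnit {Y : Type*} [AddCommGroup Y] [Lattice Y] (e : Y) : Prop :=
  0 ≤ e ∧ ∀ x : Y, e ⊓ |x| = 0 → x = 0

/-! ### The Bishop–Phelps–Bollobás property for positive operators -/

section BPBp

variable (X Y : Type*)
  [NormedAddCommGroup X] [NormedSpace ℝ X] [Lattice X]
  [NormedAddCommGroup Y] [NormedSpace ℝ Y] [Lattice Y]

/-- A positive operator maps positive elements to positive elements. -/
def IsPositiveOperator {X Y : Type*}
    [NormedAddCommGroup X] [NormedSpace ℝ X] [Lattice X]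
    [NormedAddCommGroup Y] [NormedSpace ℝ Y] [Lattice Y] (T : X →L[ℝ] Y) : Prop :=
  ∀ x : X, 0 ≤ x → 0 ≤ T x

/-- The condition in the property for given `ε` and given value `η` of `η(ε)`. -/
def BPBpPosAt (ε η : ℝ) : Prop :=
  0 < η ∧ η < ε ∧
    ∀ S : X →L[ℝ] Y, ‖S‖ = 1 → IsPositiveOperator S →
      ∀ x₀ : X, ‖x₀‖ = 1 → ‖S x₀‖ > 1 - η →
        ∃ (u₀ : X) (T : X →L[ℝ] Y), ‖u₀‖ = 1 ∧ ‖T‖ = 1 ∧ IsPositiveOperator T ∧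
          ‖T u₀‖ = 1 ∧ ‖u₀ - x₀‖ < ε ∧ ‖T - S‖ < ε

/-- The pair `(X, Y)` has the Bishop–Phelps–Bollobás property for positive operators,
witnessed by the function `η`. Only the values of `η` on `(0, 1)` matter. -/
def HasBPBpPosWith (η : ℝ → ℝ) : Prop :=
  ∀ ε : ℝ, 0 < ε → ε < 1 → BPBpPosAt X Y ε (η ε)

/-- The pair `(X, Y)` has the Bishop–Phelps–Bollobás property for positive operators. -/
def HasBPBpPos : Prop :=
  ∀ ε : ℝ, 0 < ε → ε < 1 → ∃ η : ℝ, BPBpPosAt X Y ε η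

end BPBp

/-! Let `z = S x₀` and `r = ε / 2`. Uniform monotonicity and completeness make bounded increasing
positive sequences converge, so `z⁺` and `z⁻` have band projections `P` and `Q` with disjoint ranges
on positive elements. Stretch `x₀` by `1 / (1 - r)` and truncate to `[-1, 1]` to get `u`; choose
cutoffs `φ`, `ψ` with values in `[0, 1]`, living where `u = 1` and `u = -1`. The operator `T f = P
(S (φ f)) + Q (S (ψ f))` satisfies `0 ≤ T ≤ S`. By disjointness `|T u| = P (S φ) + Q (S ψ)`, which
dominates `|T f|` on the unit ball, so `T` attains its norm at `u`. For `g ≥ |u|` in the unit ball,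
`|S x₀| ≤ (1 - r) S g + r T g`, that is, `|S x₀| + r (S - T) g ≤ S g`. The right side has norm at
most `1` and `‖S x₀‖` is nearly `1`, so uniform monotonicity makes `(S - T) g` small. Normalising
`T` finishes the proof. The main lemmas are `UniformlyMonotone.exists_disjoint_projections` and
`exists_multipliers`. -/

open Filter Topology

/-! ### Disjointness in lattice-ordered groups. -/

section LatticeGroup

variable {Y : Type*} [AddCommGroup Y] [Lattice Y] [IsOrderedAddMonoid Y]

/-- Translations distribute over `⊓`, so the right side is the infimum of `a + a`, `a + c`, `b + a`,
`b + c`; the first three dominate `a`. -/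
theorem inf_add_le_inf_add_inf {a b c : Y} (ha : 0 ≤ a) (hb : 0 ≤ b) (hc : 0 ≤ c) :
    a ⊓ (b + c) ≤ a ⊓ b + a ⊓ c := by
  rw [inf_add, add_inf, add_inf]
  refine le_inf (le_inf ?_ ?_) (le_inf ?_ inf_le_right)
  · exact inf_le_left.trans (le_add_of_nonneg_left ha)
  · exact inf_le_left.trans (le_add_of_nonneg_right hc)
  · exact inf_le_left.trans (le_add_of_nonneg_left hb)

theorem inf_nsmul_eq_zero {a b : Y} (h : a ⊓ b = 0) (n : ℕ) : a ⊓ n • b = 0 := by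
  have ha : 0 ≤ a := h ▸ inf_le_left
  have hb : 0 ≤ b := h ▸ inf_le_right
  induction n with
  | zero => simpa using ha
  | succ n ih =>
    refine le_antisymm ?_ (le_inf ha (nsmul_nonneg hb _))
    rw [succ_nsmul]
    exact (inf_add_le_inf_add_inf ha (nsmul_nonneg hb n) hb).trans (by rw [ih, h, add_zero])

theorem nsmul_inf_nsmul_eq_zero {a b : Y} (h : a ⊓ b = 0) (m n : ℕ) : m • a ⊓ n • b = 0 := by
  rw [inf_comm]
  exact inf_nsmul_eq_zero (by rw [inf_comm]; exact inf_nsmul_eq_zero h n) m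

theorem add_le_of_inf_eq_zero {a b c : Y} (h : a ⊓ b = 0) (ha : a ≤ c) (hb : b ≤ c) :
    a + b ≤ c := by
  rw [← inf_add_sup, h, zero_add]
  exact sup_le ha hb

theorem abs_sub_le_add_of_nonneg {a b : Y} (ha : 0 ≤ a) (hb : 0 ≤ b) : |a - b| ≤ a + b :=
  sup_le ((sub_le_self a hb).trans (le_add_of_nonneg_right hb))
    ((neg_sub a b).trans_le ((sub_le_self b ha).trans (le_add_of_nonneg_left ha)))

theorem abs_sub_eq_add_of_inf_eq_zero {a b : Y} (h : a ⊓ b = 0) : |a - b| = a + b := by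
  have ha : 0 ≤ a := h ▸ inf_le_left
  have hb : 0 ≤ b := h ▸ inf_le_right
  refine le_antisymm ?_ (add_le_of_inf_eq_zero h ?_ ?_)
  · exact abs_sub_le_add_of_nonneg ha hb
  -- Meeting this with `a` splits the bound into `a ⊓ |a - b|` and `a ⊓ b = 0`, hence `a ≤ |a - b|`.
  · have h1 : a ≤ |a - b| + b := sub_le_iff_le_add.1 (le_abs_self _)
    have h2 := (le_inf le_rfl h1).trans
      (inf_add_le_inf_add_inf ha (abs_nonneg (a - b)) hb)
    rw [h, add_zero] at h2
    exact h2.trans inf_le_right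
  · have h1 : b ≤ |a - b| + a := sub_le_iff_le_add.1 ((le_abs_self _).trans_eq (abs_sub_comm b a))
    have h2 := (le_inf le_rfl h1).trans
      (inf_add_le_inf_add_inf hb (abs_nonneg (a - b)) ha)
    rw [inf_comm b a, h, add_zero] at h2
    exact h2.trans inf_le_right

end LatticeGroup

/-! ### Monotone convergence and band projections under uniform monotonicity. -/

section NormedLattice

theorem norm_le_mul_of_norm_add_le {Y : Type*} [NormedAddCommGroup Y] [NormedSpace ℝ Y]
    [Lattice Y] [IsOrderedModule ℝ Y] {ε δ : ℝ}
    (H : ∀ x y : Y, 0 ≤ x → 0 ≤ y → ‖x‖ = 1 → ‖x + y‖ ≤ 1 + δ → ‖y‖ ≤ ε)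
    {x y : Y} (hx : 0 ≤ x) (hy : 0 ≤ y) (hx0 : 0 < ‖x‖) (hxy : ‖x + y‖ ≤ (1 + δ) * ‖x‖) :
    ‖y‖ ≤ ε * ‖x‖ := by
  have hinv : 0 ≤ ‖x‖⁻¹ := inv_nonneg.2 hx0.le
  have key := H (‖x‖⁻¹ • x) (‖x‖⁻¹ • y) (smul_nonneg hinv hx) (smul_nonneg hinv hy)
    (by rw [norm_smul_of_nonneg hinv, inv_mul_cancel₀ hx0.ne'])
    (by rwa [← smul_add, norm_smul_of_nonneg hinv, inv_mul_le_iff₀ hx0, mul_comm])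
  rwa [norm_smul_of_nonneg hinv, inv_mul_le_iff₀ hx0, mul_comm] at key

variable {Y : Type*} [NormedAddCommGroup Y] [Lattice Y] [IsOrderedAddMonoid Y] [HasSolidNorm Y]

theorem norm_le_norm_of_nonneg_of_le {a b : Y} (ha : 0 ≤ a) (hab : a ≤ b) : ‖a‖ ≤ ‖b‖ :=
  norm_le_norm_of_abs_le_abs (by rwa [abs_of_nonneg ha, abs_of_nonneg (ha.trans hab)])

theorem norm_le_norm_of_abs_le {a b : Y} (hab : |a| ≤ b) : ‖a‖ ≤ ‖b‖ :=
  (norm_abs_eq_norm a).symm.le.trans (norm_le_norm_of_nonneg_of_le (abs_nonneg a) hab)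

variable [NormedSpace ℝ Y] [IsOrderedModule ℝ Y]

/-- The norms increase to a limit `r`. Once `‖a N‖ > r / (1 + δ)`, adding `a n - a N ≥ 0` to `a N`
raises the norm by a factor less than `1 + δ`, so this increment is small. -/
theorem UniformlyMonotone.cauchySeq_of_monotone (hY : UniformlyMonotone Y) {a : ℕ → Y}
    (ha : Monotone a) (h0 : ∀ n, 0 ≤ a n) {C : ℝ} (hC : ∀ n, ‖a n‖ ≤ C) : CauchySeq a := by
  have hmono : Monotone fun n => ‖a n‖ := fun m n h =>
    norm_le_norm_of_nonneg_of_le (h0 m) (ha h)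
  have hbdd : BddAbove (Set.range fun n => ‖a n‖) := ⟨C, by rintro _ ⟨n, rfl⟩; exact hC n⟩
  set r := ⨆ n, ‖a n‖
  have hle : ∀ n, ‖a n‖ ≤ r := le_ciSup hbdd
  have hlim : Tendsto (fun n => ‖a n‖) atTop (𝓝 r) := tendsto_atTop_ciSup hmono hbdd
  rw [Metric.cauchySeq_iff']
  intro ε hε
  rcases ((norm_nonneg _).trans (hle 0)).eq_or_lt with hr | hr
  · refine ⟨0, fun n _ => ?_⟩
    have hz : ∀ n, a n = 0 := fun n => norm_le_zero_iff.1 ((hle n).trans hr.symm.le)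
    simpa [hz] using hε
  -- The `1 / 2` keeps the argument below `1`; the other term bounds the increments by `ε / 2`.
  obtain ⟨δ, hδ, -, H⟩ := hY (min (1 / 2) (ε / (2 * r))) (by positivity)
    ((min_le_left _ _).trans_lt (by norm_num))
  have hlt : r / (1 + δ) < r := div_lt_self hr (by linarith)
  obtain ⟨N, hN⟩ := (hlim.eventually (lt_mem_nhds hlt)).exists
  have hN0 : 0 < ‖a N‖ := (by positivity : 0 < r / (1 + δ)).trans hN
  rw [div_lt_iff₀ (by linarith)] at hN
  refine ⟨N, fun n hn => ?_⟩
  have key := norm_le_mul_of_norm_add_le H (h0 N) (sub_nonneg.2 (ha hn)) hN0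
    (by rw [add_sub_cancel]; linarith [hle n])
  rw [dist_eq_norm]
  calc ‖a n - a N‖ ≤ min (1 / 2) (ε / (2 * r)) * ‖a N‖ := key
    _ ≤ ε / (2 * r) * r := mul_le_mul (min_le_right _ _) (hle N) hN0.le (by positivity)
    _ = ε / 2 := by field_simp
    _ < ε := half_lt_self hε

/-- In a uniformly monotone Banach lattice, the projection onto the band generated by a positive
element exists. -/
theorem UniformlyMonotone.exists_bandProjection [CompleteSpace Y] (hY : UniformlyMonotone Y)
    {v : Y} (hv : 0 ≤ v) :
    ∃ P : Y →L[ℝ] Y, ∀ y, 0 ≤ y → Tendsto (fun n : ℕ => y ⊓ n • v) atTop (𝓝 (P y)) := by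
  have hex : ∀ y : Y, ∃ l, 0 ≤ y → Tendsto (fun n : ℕ => y ⊓ n • v) atTop (𝓝 l) := by
    intro y
    by_cases hy : 0 ≤ y
    · have hnn : ∀ n : ℕ, 0 ≤ y ⊓ n • v := fun n => le_inf hy (nsmul_nonneg hv n)
      obtain ⟨l, hl⟩ := cauchySeq_tendsto_of_complete (hY.cauchySeq_of_monotone
        (a := fun n : ℕ => y ⊓ n • v)
        (fun m n h => inf_le_inf_left y (nsmul_le_nsmul_left hv h)) hnn (C := ‖y‖)
        fun n => norm_le_norm_of_nonneg_of_le (hnn n) inf_le_left)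
      exact ⟨l, fun _ => hl⟩
    · exact ⟨0, fun h => absurd h hy⟩
  choose p hp using hex
  have hadd : ∀ x y, 0 ≤ x → 0 ≤ y → p (x + y) = p x + p y := by
    intro x y hx hy
    have hxy := hp (x + y) (add_nonneg hx hy)
    have hsum := (hp x hx).add (hp y hy)
    -- For `≥`, the sum of the `n`-th truncations of `x` and `y` lies below the `2 * n`-th
    -- truncation of `x + y`, so a subsequence is used.
    refine le_antisymm (le_of_tendsto_of_tendsto' hxy hsum fun n => ?_)
      (le_of_tendsto_of_tendsto' hsum
        (hxy.comp (tendsto_id.atTop_mul_const' (r := 2) two_pos)) fun n => ?_)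
    · have h0 : 0 ≤ n • v := nsmul_nonneg hv n
      rw [inf_comm, inf_comm x, inf_comm y]
      exact inf_add_le_inf_add_inf h0 hx hy
    · refine le_inf (add_le_add inf_le_left inf_le_left) ?_
      simp only [id, mul_two, add_nsmul]
      exact add_le_add inf_le_right inf_le_right
  have hnn : ∀ y, 0 ≤ y → 0 ≤ p y := fun y hy =>
    ge_of_tendsto' (hp y hy) fun n => le_inf hy (nsmul_nonneg hv n)
  have hle : ∀ y, 0 ≤ y → p y ≤ y := fun y hy => le_of_tendsto' (hp y hy) fun n => inf_le_left
  have hp0 : p 0 = 0 := by simpa using hadd 0 0 le_rfl le_rfl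
  let f : Y →+ Y := AddMonoidHom.mk' (fun y => p y⁺ - p y⁻) fun x y => by
    have h : (x + y)⁺ + (x⁻ + y⁻) = (x + y)⁻ + (x⁺ + y⁺) := by
      have h1 := posPart_sub_negPart (x + y)
      have h2 := posPart_sub_negPart x
      have h3 := posPart_sub_negPart y
      rw [sub_eq_iff_eq_add] at h1
      rw [h1]
      nth_rewrite 1 [← h2, ← h3]
      abel
    have h' := congrArg p h
    have hn := @negPart_nonneg Y _ _
    have hq := @posPart_nonneg Y _ _
    rw [hadd _ _ (hq _) (add_nonneg (hn _) (hn _)), hadd _ _ (hn _) (add_nonneg (hq _) (hq _)),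
      hadd _ _ (hn _) (hn _), hadd _ _ (hq _) (hq _)] at h'
    rw [sub_add_sub_comm, sub_eq_sub_iff_add_eq_add, h', add_comm]
  have hf : Continuous f := by
    refine AddMonoidHomClass.continuous_of_bound f 1 fun y => ?_
    rw [one_mul]
    refine norm_le_norm_of_abs_le_abs ?_
    have h1 := hle _ (posPart_nonneg y)
    have h2 := hle _ (negPart_nonneg y)
    calc |p y⁺ - p y⁻| ≤ p y⁺ + p y⁻ :=
          abs_sub_le_add_of_nonneg (hnn _ (posPart_nonneg y)) (hnn _ (negPart_nonneg y))
      _ ≤ y⁺ + y⁻ := add_le_add h1 h2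
      _ = |y| := posPart_add_negPart y
  -- A continuous additive map is real-linear, so homogeneity needs no separate proof.
  refine ⟨f.toRealLinearMap hf, fun y hy => ?_⟩
  have : f.toRealLinearMap hf y = p y := by
    change p y⁺ - p y⁻ = p y
    rw [posPart_of_nonneg hy, negPart_of_nonneg hy, hp0, sub_zero]
  rw [this]
  exact hp y hy

/-- The positive and negative parts of `z` generate disjoint bands, and the corresponding
projections `P`, `Q` control `z` from any decomposition `z = a - b` into positive elements. -/
theorem UniformlyMonotone.exists_disjoint_projections [CompleteSpace Y]
    (hY : UniformlyMonotone Y) (z : Y) :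
    ∃ P Q : Y →L[ℝ] Y, (∀ y, 0 ≤ y → 0 ≤ P y) ∧ (∀ y, 0 ≤ y → 0 ≤ Q y) ∧
      (∀ a b, 0 ≤ a → 0 ≤ b → P a ⊓ Q b = 0) ∧ (∀ y, 0 ≤ y → P y + Q y ≤ y) ∧
      ∀ a b, 0 ≤ a → 0 ≤ b → z = a - b → |z| ≤ P a + Q b := by
  obtain ⟨P, hP⟩ := hY.exists_bandProjection (posPart_nonneg z)
  obtain ⟨Q, hQ⟩ := hY.exists_bandProjection (negPart_nonneg z)
  have hdisj : ∀ a b, 0 ≤ a → 0 ≤ b → P a ⊓ Q b = 0 := by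
    intro a b ha hb
    -- The truncations by `n • z⁺` and `n • z⁻` are disjoint for each `n`, and `⊓` is continuous.
    refine tendsto_nhds_unique ((hP a ha).inf_nhds (hQ b hb)) ?_
    refine tendsto_const_nhds.congr fun n => le_antisymm ?_ ?_
    · exact le_inf (le_inf ha (nsmul_nonneg (posPart_nonneg z) n))
        (le_inf hb (nsmul_nonneg (negPart_nonneg z) n))
    · exact (inf_le_inf inf_le_right inf_le_right).trans_eq
        (nsmul_inf_nsmul_eq_zero (posPart_inf_negPart_eq_zero z) n n)
  have ge {v a : Y} {R : Y →L[ℝ] Y} (hv : 0 ≤ v) (hva : v ≤ a)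
      (hR : Tendsto (fun n : ℕ => a ⊓ n • v) atTop (𝓝 (R a))) : v ≤ R a :=
    ge_of_tendsto hR ((eventually_ge_atTop 1).mono fun n hn => le_inf hva
      ((one_nsmul v).symm.le.trans (nsmul_le_nsmul_left hv hn)))
  refine ⟨P, Q, fun y hy => ?_, fun y hy => ?_, hdisj, fun y hy => ?_, fun a b ha hb h => ?_⟩
  · exact (hdisj y y hy hy).symm.le.trans inf_le_left
  · exact (hdisj y y hy hy).symm.le.trans inf_le_right
  · exact add_le_of_inf_eq_zero (hdisj y y hy hy)
      (le_of_tendsto' (hP y hy) fun n => inf_le_left)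
      (le_of_tendsto' (hQ y hy) fun n => inf_le_left)
  · rw [← posPart_add_negPart z]
    refine add_le_add (ge (posPart_nonneg z) ?_ (hP a ha))
      (ge (negPart_nonneg z) ?_ (hQ b hb))
    · exact sup_le (h ▸ sub_le_self a hb) ha
    · exact sup_le (by rw [h, neg_sub]; exact sub_le_self b ha) hb

end NormedLattice

/-! ### Functions vanishing at infinity, positive operators, and multipliers. -/

namespace ZeroAtInftyContinuousMap

variable {L : Type*} [TopologicalSpace L]

/-- Postcomposition of a function vanishing at infinity with a continuous function fixing `0`. -/
def postcomp (h : ℝ → ℝ) (hc : Continuous h) (h0 : h 0 = 0) (f : C₀(L, ℝ)) : C₀(L, ℝ) where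
  toFun t := h (f t)
  continuous_toFun := hc.comp (map_continuous f)
  zero_at_infty' := by
    have := (hc.tendsto 0).comp (zero_at_infty f)
    rwa [h0] at this

theorem norm_le_iff_real {f : C₀(L, ℝ)} {C : ℝ} (hC : 0 ≤ C) : ‖f‖ ≤ C ↔ ∀ t, |f t| ≤ C := by
  rw [← norm_toBCF_eq_norm]
  exact BoundedContinuousFunction.norm_le hC

theorem abs_apply_le_norm (f : C₀(L, ℝ)) (t : L) : |f t| ≤ ‖f‖ :=
  (norm_le_iff_real (norm_nonneg f)).1 le_rfl t

end ZeroAtInftyContinuousMap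

theorem IsPositiveOperator.mono {X Y : Type*}
    [NormedAddCommGroup X] [NormedSpace ℝ X] [Lattice X] [IsOrderedAddMonoid X]
    [NormedAddCommGroup Y] [NormedSpace ℝ Y] [Lattice Y] [IsOrderedAddMonoid Y]
    {T : X →L[ℝ] Y} (hT : IsPositiveOperator T) {a b : X} (h : a ≤ b) : T a ≤ T b :=
  sub_nonneg.1 (map_sub T b a ▸ hT _ (sub_nonneg.2 h))

theorem IsPositiveOperator.abs_apply_le {X Y : Type*}
    [NormedAddCommGroup X] [NormedSpace ℝ X] [Lattice X] [IsOrderedAddMonoid X]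
    [NormedAddCommGroup Y] [NormedSpace ℝ Y] [Lattice Y] [IsOrderedAddMonoid Y]
    {T : X →L[ℝ] Y} (hT : IsPositiveOperator T) {a b : X} (h : |a| ≤ b) : |T a| ≤ T b :=
  sup_le (hT.mono ((le_abs_self a).trans h))
    (map_neg T a ▸ hT.mono ((neg_le_abs a).trans h))

/-- Normalising moves `T` by `|1 - ‖T‖| = |‖S‖ - ‖T‖| ≤ ‖T - S‖`. -/
theorem norm_inv_norm_smul_sub_le {E : Type*} [NormedAddCommGroup E] [NormedSpace ℝ E] {S T : E}
    (hS : ‖S‖ = 1) (hT : T ≠ 0) : ‖‖T‖⁻¹ • T - S‖ ≤ 2 * ‖T - S‖ := by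
  have hT0 : 0 < ‖T‖ := norm_pos_iff.2 hT
  have h : ‖‖T‖⁻¹ • T - T‖ ≤ ‖T - S‖ := by
    have h1 : ‖T‖⁻¹ • T - T = (‖T‖⁻¹ - 1) • T := by module
    rw [h1, norm_smul, Real.norm_eq_abs, ← abs_norm T, ← abs_mul, abs_norm, sub_mul,
      inv_mul_cancel₀ hT0.ne', one_mul, ← hS, norm_sub_rev T S]
    exact abs_norm_sub_norm_le S T
  linarith [norm_sub_le_norm_sub_add_norm_sub (‖T‖⁻¹ • T) T S]

/-- The right side equals `max (1 - r) x * g`. Below the threshold `1 - r` one has `g ≥ x / (1 -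
r)`, above it `g ≥ 1`. -/
theorem max_zero_le_of_min_div_le {x r g : ℝ} (hr : 0 < r) (hr1 : r < 1)
    (hg : min 1 (x / (1 - r)) ≤ g) (hg0 : 0 ≤ g) :
    max x 0 ≤ (1 - r) * g + r * (max 0 (x - (1 - r)) / r * g) := by
  have hs : 0 < 1 - r := sub_pos.2 hr1
  rw [← mul_assoc, mul_div_cancel₀ _ hr.ne', ← add_mul]
  rcases le_total x (1 - r) with h | h
  · rw [min_eq_right ((div_le_one hs).2 h), div_le_iff₀ hs] at hg
    rw [max_eq_left (sub_nonpos.2 h), add_zero, mul_comm]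
    exact max_le hg (mul_nonneg hg0 hs.le)
  · have hx : 0 ≤ x := hs.le.trans h
    rw [min_eq_left ((one_le_div hs).2 h)] at hg
    rw [max_eq_right (sub_nonneg.2 h), add_sub_cancel, max_eq_left hx]
    exact le_mul_of_one_le_right hx hg

open ZeroAtInftyContinuousMap in
/-- An element `x` of norm one is within `r` of some `u` with `‖u‖ ≤ 1` for which there are
multipliers `φ`, `ψ` living where `u = 1` and where `u = -1`, such that the positive and negative
parts of `x` are dominated by `((1 - r) + r φ) g` and `((1 - r) + r ψ) g` whenever `|u| ≤ g`. -/
theorem ZeroAtInftyContinuousMap.exists_multipliers {L : Type*} [TopologicalSpace L]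
    (x : C₀(L, ℝ)) (hx : ‖x‖ = 1) {r : ℝ} (hr : 0 < r) (hr1 : r < 1) :
    ∃ u φ ψ p n : C₀(L, ℝ), ‖u‖ ≤ 1 ∧ ‖u - x‖ ≤ r ∧ (∀ t, 0 ≤ φ t) ∧ (∀ t, 0 ≤ ψ t) ∧
      (∀ t, φ t ≤ 1) ∧ (∀ t, ψ t ≤ 1) ∧ φ * u = φ ∧ ψ * u = -ψ ∧ 0 ≤ p ∧ 0 ≤ n ∧ x = p - n ∧
      ∀ g : C₀(L, ℝ), |u| ≤ g →
        p ≤ (1 - r) • g + r • (φ * g) ∧ n ≤ (1 - r) • g + r • (ψ * g) := by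
  have hs : 0 < 1 - r := sub_pos.2 hr1
  have hxt : ∀ t, |x t| ≤ 1 := fun t => hx ▸ abs_apply_le_norm x t
  -- The second function is zero up to the level `1 - r`, where truncation of `u` begins, and rises
  -- linearly to `1` at level `1`; the third does the same for `-x`. The last two are the positive
  -- and negative parts of `x`.
  refine ⟨postcomp (fun s => max (-1) (min 1 (s / (1 - r)))) (by fun_prop) (by simp) x,
    postcomp (fun s => max 0 (s - (1 - r)) / r) (by fun_prop) (by simp [hr1.le]) x,
    postcomp (fun s => max 0 (-s - (1 - r)) / r) (by fun_prop) (by simp [hr1.le]) x,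
    postcomp (fun s => max s 0) (by fun_prop) (by simp) x,
    postcomp (fun s => max (-s) 0) (by fun_prop) (by simp) x,
    (norm_le_iff_real zero_le_one).2 fun t => ?_, (norm_le_iff_real hr.le).2 fun t => ?_,
    fun t => ?_, fun t => ?_, fun t => ?_, fun t => ?_, ext fun t => ?_, ext fun t => ?_,
    fun t => le_max_right _ _, fun t => le_max_right _ _, ext fun t => ?_,
    fun g hg => ⟨fun t => ?_, fun t => ?_⟩⟩
  · change |max (-1) (min 1 (x t / (1 - r)))| ≤ 1
    exact abs_le.2 ⟨le_max_left _ _, max_le (by norm_num) (min_le_left _ _)⟩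
  · change |max (-1) (min 1 (x t / (1 - r))) - x t| ≤ r
    have h := abs_le.1 (hxt t)
    rcases le_total 1 (x t / (1 - r)) with h1 | h1
    · rw [min_eq_left h1, max_eq_right (by norm_num)]
      rw [one_le_div hs] at h1
      exact abs_le.2 ⟨by linarith, by linarith⟩
    rw [min_eq_right h1]
    rcases le_total (x t / (1 - r)) (-1) with h2 | h2
    · rw [max_eq_left h2]
      rw [div_le_iff₀ hs] at h2
      exact abs_le.2 ⟨by linarith, by linarith⟩
    · rw [max_eq_right h2]
      have h3 : x t / (1 - r) - x t = r * (x t / (1 - r)) := by field_simp; ring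
      rw [h3, abs_mul, abs_of_pos hr]
      exact mul_le_of_le_one_right hr.le (abs_le.2 ⟨h2, h1⟩)
  · exact div_nonneg (le_max_left _ _) hr.le
  · exact div_nonneg (le_max_left _ _) hr.le
  · exact (div_le_one hr).2 (max_le hr.le (by linarith [abs_le.1 (hxt t)]))
  · exact (div_le_one hr).2 (max_le hr.le (by linarith [abs_le.1 (hxt t)]))
  · change max 0 (x t - (1 - r)) / r * max (-1) (min 1 (x t / (1 - r))) =
      max 0 (x t - (1 - r)) / r
    rcases le_total (x t) (1 - r) with h | h
    · rw [max_eq_left (sub_nonpos.2 h)]; simp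
    · rw [min_eq_left ((one_le_div hs).2 h)]; norm_num
  · change max 0 (-x t - (1 - r)) / r * max (-1) (min 1 (x t / (1 - r))) =
      -(max 0 (-x t - (1 - r)) / r)
    rcases le_total (-x t) (1 - r) with h | h
    · rw [max_eq_left (sub_nonpos.2 h)]; simp
    · have h1 : x t / (1 - r) ≤ -1 := (div_le_iff₀ hs).2 (by linarith)
      rw [max_eq_left ((min_le_right _ _).trans h1)]; ring
  · change x t = max (x t) 0 - max (-x t) 0
    rcases le_total (x t) 0 with h | h
    · rw [max_eq_right h, max_eq_left (neg_nonneg.2 h)]; ring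
    · rw [max_eq_left h, max_eq_right (neg_nonpos.2 h)]; ring
  · change max (x t) 0 ≤ (1 - r) * g t + r * (max 0 (x t - (1 - r)) / r * g t)
    have hgt : |max (-1) (min 1 (x t / (1 - r)))| ≤ g t := hg t
    exact max_zero_le_of_min_div_le hr hr1 
      ((le_max_right _ _).trans ((le_abs_self _).trans hgt)) ((abs_nonneg _).trans hgt)
  · change max (-x t) 0 ≤ (1 - r) * g t + r * (max 0 (-x t - (1 - r)) / r * g t)
    have hgt : |max (-1) (min 1 (x t / (1 - r)))| ≤ g t := hg t
    refine max_zero_le_of_min_div_le hr hr1 (le_trans ?_ ((neg_le_abs _).trans hgt))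
      ((abs_nonneg _).trans hgt)
    rw [neg_div, le_neg]
    exact max_le (neg_le_neg (min_le_left _ _))
      ((min_le_right _ _).trans (le_neg.1 (min_le_right _ _)))

/-! ### Construction of the norm-attaining operator and the main theorem. -/

open ZeroAtInftyContinuousMap in
theorem bPBpPosAt_of_modulus (L : Type*) [TopologicalSpace L]
    (Y : Type*) [NormedAddCommGroup Y] [NormedSpace ℝ Y] [CompleteSpace Y]
    [Lattice Y] [IsOrderedAddMonoid Y] [IsOrderedModule ℝ Y] [HasSolidNorm Y]
    (hY : UniformlyMonotone Y) {ε δ : ℝ} (hε : 0 < ε) (hε1 : ε < 1) (hδ : 0 < δ)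
    (hδε : δ ≤ ε ^ 2 / 8)
    (H : ∀ x y : Y, 0 ≤ x → 0 ≤ y → ‖x‖ = 1 → ‖x + y‖ ≤ 1 + δ → ‖y‖ ≤ ε ^ 2 / 8) :
    BPBpPosAt C₀(L, ℝ) Y ε (δ / 2) := by
  refine ⟨half_pos hδ, by nlinarith, fun S hS hSpos x₀ hx₀ hSx₀ => ?_⟩
  obtain ⟨u, φ, ψ, p, n, hu, hux, hφ, hψ, hφ1, hψ1, hφu, hψu, hp, hn, hpn, hdom⟩ :=
    exists_multipliers x₀ hx₀ (half_pos hε) (by linarith)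
  obtain ⟨P, Q, hP, hQ, hdisj, hPQ, hz⟩ := hY.exists_disjoint_projections (S x₀)
  let T : C₀(L, ℝ) →L[ℝ] Y := P ∘L S ∘L ContinuousLinearMap.mul ℝ C₀(L, ℝ) φ +
    Q ∘L S ∘L ContinuousLinearMap.mul ℝ C₀(L, ℝ) ψ
  have hT : ∀ f, T f = P (S (φ * f)) + Q (S (ψ * f)) := fun f => rfl
  have hPS : IsPositiveOperator (P ∘L S) := fun f hf => hP _ (hSpos f hf)
  have hQS : IsPositiveOperator (Q ∘L S) := fun f hf => hQ _ (hSpos f hf)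
  have hTpos : IsPositiveOperator T := fun f hf => add_nonneg
    (hPS _ fun t => mul_nonneg (hφ t) (hf t)) (hQS _ fun t => mul_nonneg (hψ t) (hf t))
  have hSTpos : IsPositiveOperator (S - T) := fun f hf => by
    refine sub_nonneg.2 (le_trans ?_ (hPQ (S f) (hSpos f hf)))
    exact add_le_add (hPS.mono fun t => mul_le_of_le_one_left (hf t) (hφ1 t))
      (hQS.mono fun t => mul_le_of_le_one_left (hf t) (hψ1 t))
  have hTu : |T u| = P (S φ) + Q (S ψ) := by
    rw [hT, hφu, hψu, map_neg, map_neg, ← sub_eq_add_neg]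
    exact abs_sub_eq_add_of_inf_eq_zero (hdisj _ _ (hSpos φ hφ) (hSpos ψ hψ))
  -- For `‖f‖ = 1`, positivity gives `|T f| ≤ T |f| ≤ P (S φ) + Q (S ψ) = |T u|`.
  have hnorm : ‖T‖ = ‖T u‖ := by
    refine le_antisymm (T.opNorm_le_of_unit_norm (norm_nonneg _) fun f hf => ?_)
      ((T.le_opNorm u).trans (mul_le_of_le_one_right (norm_nonneg _) hu))
    rw [← norm_abs_eq_norm (T u), hTu]
    have hf1 : ∀ t, |f t| ≤ 1 := fun t => hf ▸ abs_apply_le_norm f t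
    refine norm_le_norm_of_abs_le ((hTpos.abs_apply_le le_rfl).trans ?_)
    exact add_le_add (hPS.mono fun t => mul_le_of_le_one_right (hφ t) (hf1 t))
      (hQS.mono fun t => mul_le_of_le_one_right (hψ t) (hf1 t))
  have hST : ‖S - T‖ ≤ ε / 4 := by
    refine (S - T).opNorm_le_of_unit_norm (by positivity) fun f hf => ?_
    -- Dominating `|u|` makes the multiplier estimate apply; dominating `|f|` transfers the bound on
    -- `(S - T) g` to `(S - T) f`.
    set g : C₀(L, ℝ) := |f| ⊔ |u|
    have hg1 : ‖g‖ ≤ 1 := by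
      refine (norm_le_iff_real zero_le_one).2 fun t => ?_
      have h0 : |g t| = |f t| ⊔ |u t| := abs_of_nonneg ((abs_nonneg _).trans le_sup_left)
      rw [h0]
      exact sup_le ((abs_apply_le_norm f t).trans hf.le) ((abs_apply_le_norm u t).trans hu)
    have hg0 : 0 ≤ g := (abs_nonneg f).trans le_sup_left
    have hy : 0 ≤ (ε / 2) • (S - T) g := smul_nonneg (by positivity) (hSTpos g hg0)
    have key : |S x₀| + (ε / 2) • (S - T) g ≤ S g := by
      have h1 := hz (S p) (S n) (hSpos p hp) (hSpos n hn) (by rw [hpn, map_sub])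
      have h2 := add_le_add (hPS.mono (hdom g le_sup_right).1) (hQS.mono (hdom g le_sup_right).2)
      have h3 : (1 - ε / 2) • (P (S g) + Q (S g)) ≤ (1 - ε / 2) • S g :=
        smul_le_smul_of_nonneg_left (hPQ _ (hSpos g hg0)) (by linarith)
      have h4 : |S x₀| ≤ (1 - ε / 2) • (P (S g) + Q (S g)) + (ε / 2) • T g := by
        refine (h1.trans h2).trans_eq ?_
        simp only [hT, map_add, map_smul, smul_add, ContinuousLinearMap.comp_apply]
        abel
      calc |S x₀| + (ε / 2) • (S - T) g
          ≤ (1 - ε / 2) • S g + (ε / 2) • T g + (ε / 2) • (S - T) g := by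
            gcongr
            exact h4.trans (by gcongr)
        _ = S g := by
            rw [_root_.sub_apply]
            module
    have hSg : ‖|S x₀| + (ε / 2) • (S - T) g‖ ≤ 1 :=
      (norm_le_norm_of_nonneg_of_le (add_nonneg (abs_nonneg _) hy) key).trans
        ((S.le_opNorm g).trans (by rw [hS, one_mul]; exact hg1))
    have hx1 : ‖S x₀‖ ≤ 1 := (S.le_opNorm x₀).trans (by rw [hS, hx₀, one_mul])
    have hbig := norm_le_mul_of_norm_add_le H (abs_nonneg (S x₀)) hy
      (by rw [norm_abs_eq_norm]; nlinarith)
      (hSg.trans (by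
        rw [norm_abs_eq_norm]
        have hδ1 : δ ≤ 1 := by nlinarith
        -- The choice `η = δ / 2` works because `(1 + δ) * (1 - δ / 2) ≥ 1` when `δ ≤ 1`.
        have hlow : (1 + δ) * (1 - δ / 2) ≤ (1 + δ) * ‖S x₀‖ :=
          mul_le_mul_of_nonneg_left hSx₀.le (by positivity)
        nlinarith))
    rw [norm_abs_eq_norm, norm_smul_of_nonneg (by positivity)] at hbig
    have hle : ‖(S - T) f‖ ≤ ‖(S - T) g‖ :=
      norm_le_norm_of_abs_le (hSTpos.abs_apply_le le_sup_left)
    have : ε ^ 2 / 8 * ‖S x₀‖ ≤ ε ^ 2 / 8 := mul_le_of_le_one_right (by positivity) hx1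
    have h5 : ε / 2 * ‖(S - T) g‖ ≤ ε / 2 * (ε / 4) := by linarith
    exact hle.trans (le_of_mul_le_mul_left h5 (by positivity))
  have hT0 : 0 < ‖T‖ := by linarith [norm_le_norm_add_norm_sub' S T]
  -- The bound `‖u‖ ≤ 1` cannot be strict, since `T ≠ 0` attains its norm at `u`.
  have hu1 : ‖u‖ = 1 := by
    refine le_antisymm hu (le_of_mul_le_mul_left ?_ hT0)
    rw [mul_one]
    exact hnorm.le.trans (T.le_opNorm u)
  refine ⟨u, ‖T‖⁻¹ • T, hu1, ?_, fun f hf => smul_nonneg (inv_nonneg.2 hT0.le) (hTpos f hf),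
    ?_, hux.trans_lt (half_lt_self hε), ?_⟩
  · exact norm_smul_inv_norm (𝕜 := ℝ) (norm_pos_iff.1 hT0)
  · rw [_root_.smul_apply, norm_smul_of_nonneg (inv_nonneg.2 hT0.le), ← hnorm,
      inv_mul_cancel₀ hT0.ne']
  · have h1 := norm_inv_norm_smul_sub_le hS (norm_pos_iff.1 hT0)
    rw [norm_sub_rev T S] at h1
    exact h1.trans_lt (by linarith)

theorem IsUniformMonotonicityModulus.uniformlyMonotone {Y : Type*} [NormedAddCommGroup Y]
    [Lattice Y] {δ : ℝ → ℝ} (h : IsUniformMonotonicityModulus Y δ) : UniformlyMonotone Y :=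
  fun ε h0 h1 => ⟨δ ε, h ε h0 h1⟩

theorem IsUniformMonotonicityModulus.hasBPBpPosWith (L : Type*) [TopologicalSpace L]
    {Y : Type*} [NormedAddCommGroup Y] [NormedSpace ℝ Y] [CompleteSpace Y]
    [Lattice Y] [IsOrderedAddMonoid Y] [IsOrderedModule ℝ Y] [HasSolidNorm Y]
    {δ : ℝ → ℝ} (h : IsUniformMonotonicityModulus Y δ) :
    HasBPBpPosWith C₀(L, ℝ) Y fun ε => δ (ε ^ 2 / 8) / 2 := fun ε h0 h1 => by
  -- Here `ε ^ 2 / 8` is `(ε / 2) * (ε / 4)`: dividing by `r = ε / 2` leaves `‖S - T‖ ≤ ε / 4`,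
  -- which normalisation at most doubles.
  obtain ⟨hδ, hδε, H⟩ := h (ε ^ 2 / 8) (by positivity) (by nlinarith)
  exact bPBpPosAt_of_modulus L Y h.uniformlyMonotone h0 h1 hδ hδε H

theorem mainTheorem1 :
    -- the pair has the property
    (∀ (L : Type u) [TopologicalSpace L] [LocallyCompactSpace L] [T2Space L]
      (Y : Type v) [NormedAddCommGroup Y] [NormedSpace ℝ Y] [CompleteSpace Y]
      [Lattice Y] [IsOrderedAddMonoid Y] [IsOrderedModule ℝ Y] [HasSolidNorm Y],
      UniformlyMonotone Y → (∃ e : Y, IsWeakUnit e) → HasBPBpPos C₀(L, ℝ) Y) ∧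
    -- the function `η` depends only on the modulus `δ` of uniform monotonicity
    (∀ δ : ℝ → ℝ, ∃ η : ℝ → ℝ,
      ∀ (L : Type u) [TopologicalSpace L] [LocallyCompactSpace L] [T2Space L]
        (Y : Type v) [NormedAddCommGroup Y] [NormedSpace ℝ Y] [CompleteSpace Y]
        [Lattice Y] [IsOrderedAddMonoid Y] [IsOrderedModule ℝ Y] [HasSolidNorm Y],
        IsUniformMonotonicityModulus Y δ → (∃ e : Y, IsWeakUnit e) →
          HasBPBpPosWith C₀(L, ℝ) Y η) := by
  refine ⟨fun L _ _ _ Y _ _ _ _ _ _ _ hY _ ε h0 h1 => ?_,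
    fun δ => ⟨_, fun L _ _ _ Y _ _ _ _ _ _ _ h _ => h.hasBPBpPosWith L⟩⟩
  obtain ⟨δ, hδ, hδε, H⟩ := hY (ε ^ 2 / 8) (by positivity) (by nlinarith)
  exact ⟨_, bPBpPosAt_of_modulus L Y hY h0 h1 hδ hδε H⟩
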